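/- Let $n\ge 2$, let $\mathcal M$ be a topological space (the order parameter manifold) and $\phi_0\in\mathcal M$ a base point. Write $\pi_1=\pi_1(\mathcal M,\phi_0)$ and $\pi_n=\pi_n(\mathcal M,\phi_0)$. The group $\pi_1$ acts on $\pi_n$ in the usual way; denote this action by $(\gamma,\alpha)\mapsto\gamma(\alpha)$. Let $\kappa_n=\kappa_n(\mathcal M,\phi_0)$ be the $n$th Abe homotopy group: the group of homotopy classes, relative to the two ends, of continuous maps $[0,1]\times S^{n-1}\to\mathcal M$ that send $\{0\}\times S^{n-1}\cup\{1\}\times S^{n-1}$ to $\phi_0$, with concatenation in the coordinate of $[0,1]$ as product. Let $\iota_*:\pi_1\to\kappa_n$ be the map $[l]\mapsto[(t,p)\mapsto l(t)]$, and let $\Psi_{1*}:\pi_n\to\kappa_n$ be the map induced by the map $[0,1]\times S^{n-1}\to S^n$ that collapses $\{0,1\}\times S^{n-1}\cup[0,1]\times\{s\}$ to the base point, where $s$ is a base point of $S^{n-1}$. Then the following four statements are equivalent: (a) Vortices influence the excitations: there are a loop $l$ at $\phi_0$, maps $f,g:(S^n,s_0)\to(\mathcal M,\phi_0)$, where $s_0$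 is the base point of $S^n$, and a continuous family of maps $f_t:(S^n,s_0)\to(\mathcal M,l(t))$, $0\le t\le 1$, with $f_0=f$, $f_1=g$ and $[f]\ne[g]$ in $\pi_n$. That is, the charge of some excitation changes when the excitation is carried around $l$. (b) $\mathcal M$ is not $n$-simple: $\gamma(\alpha)\neq\alpha$ for some $\gamma\in\pi_1$ and $\alpha\in\pi_n$. (c) The elements of $\pi_1$ and of $\pi_n$ do not all commute inside $\kappa_n$: $\iota_*(\gamma)\,\Psi_{1*}(\alpha)\neq\Psi_{1*}(\alpha)\,\iota_*(\gamma)$ for some $\gamma\in\pi_1$ and $\alpha\in\pi_n$. (d) $\kappa_n$ is a nontrivial semidirect product $\pi_1\ltimes\pi_n$: there are a nontrivial action of $\pi_1$ on $\pi_n$ by group automorphisms and an isomorphism from $\kappa_n$ to the corresponding semidirect product $\pi_1\ltimes\pi_n$ which carries $\iota_*$ and $\Psi_{1*}$ to the canonical inclusions of the factors $\pi_1$ and $\pi_n$. -/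

import Mathlib

open scoped unitInterval Topology

noncomputable section

namespace AbeHomotopy

variable {X : Type*} [TopologicalSpace X] {x : X} {n : ℕ}

/-! ### The Abe group -/

/-- The unit sphere `S^(n-1)` of `ℝⁿ`. -/
abbrev Sphere (n : ℕ) : Type := Metric.sphere (0 : EuclideanSpace ℝ (Fin n)) 1

/-- The union `{0} × S^(n-1) ∪ {1} × S^(n-1)` of the two ends of the cylinder `[0,1] × S^(n-1)`. -/
def cylinderEnds (n : ℕ) : Set (I × Sphere n) := {z | z.1 = 0 ∨ z.1 = 1}

/-- The set `K_n(X, x)` of continuous maps `[0,1] × S^(n-1) → X` sending both ends to `x`. -/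
def AbeLoop (n : ℕ) (X : Type*) [TopologicalSpace X] (x : X) : Type _ :=
  {F : C(I × Sphere n, X) // ∀ z ∈ cylinderEnds n, F z = x}

/-- Homotopy of elements of `K_n(X, x)`, keeping the two ends of the cylinder at `x`. -/
instance AbeLoop.setoid (n : ℕ) (X : Type*) [TopologicalSpace X] (x : X) :
    Setoid (AbeLoop n X x) where
  r F G := F.1.HomotopicRel G.1 (cylinderEnds n)
  iseqv := ⟨fun _ => .refl _, fun h => h.symm, fun h h' => h.trans h'⟩

/-- The underlying set of the `n`-th Abe group `κ_n(X, x)`: homotopy classes in `K_n(X, x)`. -/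
def AbeGroup (n : ℕ) (X : Type*) [TopologicalSpace X] (x : X) : Type _ :=
  Quotient (AbeLoop.setoid n X x)

/-- A map of the cylinder that sends both ends to `x`, seen as a loop of maps `S^(n-1) → X`. -/
def AbeLoop.equivPath : AbeLoop n X x ≃
    Path (ContinuousMap.const (Sphere n) x) (ContinuousMap.const (Sphere n) x) where
  toFun F :=
    { toContinuousMap := F.1.curry
      source' := by ext p; exact F.2 (0, p) (Or.inl rfl)
      target' := by ext p; exact F.2 (1, p) (Or.inr rfl) }
  invFun p := ⟨p.toContinuousMap.uncurry, by
    rintro ⟨t, q⟩ (h | h) <;> (simp only at h; subst h)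
    · exact DFunLike.congr_fun p.source q
    · exact DFunLike.congr_fun p.target q⟩
  left_inv F := by apply Subtype.ext; ext z; rfl
  right_inv p := by ext t q; rfl

theorem AbeLoop.homotopic_iff (F G : AbeLoop n X x) :
    F.1.HomotopicRel G.1 (cylinderEnds n) ↔ (equivPath F).Homotopic (equivPath G) := by
  constructor
  · rintro ⟨H⟩
    refine ⟨⟨⟨(H.toContinuousMap.comp
      (Homeomorph.prodAssoc I I (Sphere n) : C(_, _))).curry, ?_, ?_⟩, ?_⟩⟩
    · intro t; ext p; exact H.apply_zero (t, p)
    · intro t; ext p; exact H.apply_one (t, p)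
    · intro τ t ht; ext p
      exact H.eq_fst τ (x := (t, p)) ht
  · rintro ⟨H⟩
    refine ⟨⟨⟨H.toContinuousMap.uncurry.comp
      ((Homeomorph.prodAssoc I I (Sphere n)).symm : C(_, _)), ?_, ?_⟩, ?_⟩⟩
    · rintro ⟨t, p⟩; exact DFunLike.congr_fun (H.apply_zero t) p
    · rintro ⟨t, p⟩; exact DFunLike.congr_fun (H.apply_one t) p
    · rintro τ ⟨t, p⟩ ht
      exact DFunLike.congr_fun (H.eq_fst τ (x := t) ht) p

/-- Classes of maps of the cylinder are classes of loops of maps `S^(n-1) → X`. -/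
def AbeGroup.equivFundamentalGroup : AbeGroup n X x ≃
    FundamentalGroup C(Sphere n, X) (ContinuousMap.const (Sphere n) x) :=
  Quotient.congr AbeLoop.equivPath AbeLoop.homotopic_iff

/-- The group structure of `κ_n(X, x)`, by concatenation in the coordinate `t ∈ [0,1]`. As for
`FundamentalGroup` and `HomotopyGroup`, the product `[F] * [G]` runs first through `G`, then
through `F`. -/
instance : Group (AbeGroup n X x) := AbeGroup.equivFundamentalGroup.group

/-- Concatenation of maps of the cylinder: first `F`, then `G`. -/
def AbeLoop.trans (F G : AbeLoop n X x) : AbeLoop n X x :=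
  equivPath.symm ((equivPath F).trans (equivPath G))

/-- The concatenation is given by the usual formula. -/
theorem AbeLoop.trans_apply (F G : AbeLoop n X x) (t : I) (p : Sphere n) :
    (F.trans G).1 (t, p) = if (t : ℝ) ≤ 1 / 2 then F.1 (Set.projIcc 0 1 zero_le_one (2 * t), p)
      else G.1 (Set.projIcc 0 1 zero_le_one (2 * t - 1), p) := by
  change ((equivPath F).trans (equivPath G)) t p = _
  rw [Path.trans_apply]
  split_ifs with h
  · rw [Set.projIcc_of_mem]; rfl
  · rw [Set.projIcc_of_mem]; rfl

/-- The class in `κ_n(X, x)` of a map of the cylinder. -/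
def AbeGroup.mk (F : AbeLoop n X x) : AbeGroup n X x := Quotient.mk _ F

theorem AbeGroup.mk_mul_mk (F G : AbeLoop n X x) : mk F * mk G = mk (G.trans F) := by
  change AbeGroup.equivFundamentalGroup.symm
    (AbeGroup.equivFundamentalGroup (mk F) * AbeGroup.equivFundamentalGroup (mk G)) = _
  rw [Equiv.symm_apply_eq]
  rfl

/-! ### The inclusion of `π₁` into the Abe group -/

/-- A loop `l`, seen as the map `(t, p) ↦ l t` of the cylinder. -/
def ofLoop (n : ℕ) (l : Path x x) : AbeLoop n X x :=
  ⟨l.toContinuousMap.comp ⟨Prod.fst, continuous_fst⟩, by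
    rintro ⟨t, p⟩ (h | h) <;> (simp only at h; subst h) <;> simp⟩

/-- The map `π₁(X, x) → κ_n(X, x)`, `[l] ↦ [(t, p) ↦ l t]`. -/
def ofPiOne (n : ℕ) : FundamentalGroup X x → AbeGroup n X x :=
  Quotient.map (ofLoop n) (by
    rintro l l' ⟨H⟩
    refine ⟨⟨⟨H.toContinuousMap.comp ⟨fun z => (z.1, z.2.1), by fun_prop⟩, ?_, ?_⟩, ?_⟩⟩
    · rintro ⟨t, p⟩; exact H.apply_zero t
    · rintro ⟨t, p⟩; exact H.apply_one t
    · rintro τ ⟨t, p⟩ ht; exact H.eq_fst τ (x := t) ht)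

/-! ### The cube `[0,1]^(n-1)` with its boundary collapsed is the sphere `S^(n-1)` -/

/-- The distance of a point of a cube from the centre, in the maximum norm and scaled so that the
boundary of the cube is where it is `1`. -/
def radius {N : Type*} [Fintype N] (y : N → I) : ℝ := ‖fun j => 2 * (y j : ℝ) - 1‖

section Radius

variable {N : Type*} [Fintype N]

theorem continuous_radius : Continuous (radius : (N → I) → ℝ) := by
  unfold radius; fun_prop

theorem radius_nonneg (y : N → I) : 0 ≤ radius y := norm_nonneg _

theorem abs_le_radius (y : N → I) (j : N) : |2 * (y j : ℝ) - 1| ≤ radius y :=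
  norm_le_pi_norm (fun j => 2 * (y j : ℝ) - 1) j

theorem radius_le_one (y : N → I) : radius y ≤ 1 := by
  refine (pi_norm_le_iff_of_nonneg zero_le_one).2 fun j => ?_
  rw [Real.norm_eq_abs, abs_le]
  constructor <;> linarith [(y j).2.1, (y j).2.2]

theorem exists_abs_eq_radius (y : N → I) (h : radius y ≠ 0) :
    ∃ j, |2 * (y j : ℝ) - 1| = radius y := by
  by_contra! hne
  have hlt : ∀ j, ‖2 * (y j : ℝ) - 1‖ < radius y := fun j =>
    lt_of_le_of_ne (abs_le_radius y j) (hne j)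
  exact lt_irrefl _ ((pi_norm_lt_iff (lt_of_le_of_ne (radius_nonneg y) h.symm)).2 hlt)

theorem radius_eq_one_iff (y : N → I) : radius y = 1 ↔ y ∈ Cube.boundary N := by
  constructor
  · intro h
    obtain ⟨j, hj⟩ := exists_abs_eq_radius y (by rw [h]; exact one_ne_zero)
    rw [h] at hj
    refine ⟨j, ?_⟩
    rcases (abs_eq zero_le_one).1 hj with h' | h'
    · right; apply Subtype.ext; push_cast; linarith
    · left; apply Subtype.ext; push_cast; linarith
  · rintro ⟨j, hj⟩
    refine le_antisymm (radius_le_one y) ?_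
    have := abs_le_radius y j
    rcases hj with hj | hj <;> rw [hj] at this <;> norm_num at this <;> exact this

end Radius

section Collapse

variable [n.AtLeastTwo]

/-- The coordinates of `ℝⁿ` other than the first one. -/
abbrev Rest (n : ℕ) [n.AtLeastTwo] : Type := {j : Fin n // j ≠ 0}

/-- The denominator in the formula for the collapse. -/
def collapseDenom (y : Rest n → I) : ℝ := ∑ j, (2 * (y j : ℝ) - 1) ^ 2 + (1 - radius y) ^ 2

theorem collapseDenom_pos (y : Rest n → I) : 0 < collapseDenom y := by
  unfold collapseDenom
  have h0 : 0 ≤ ∑ j, (2 * (y j : ℝ) - 1) ^ 2 := Finset.sum_nonneg fun _ _ => sq_nonneg _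
  by_cases hr : radius y = 0
  · rw [hr]; linarith
  · obtain ⟨j, hj⟩ := exists_abs_eq_radius y hr
    have h1 : (2 * (y j : ℝ) - 1) ^ 2 ≤ ∑ j, (2 * (y j : ℝ) - 1) ^ 2 :=
      Finset.single_le_sum (f := fun j => (2 * (y j : ℝ) - 1) ^ 2)
        (fun _ _ => sq_nonneg _) (Finset.mem_univ j)
    have h2 : 0 < (2 * (y j : ℝ) - 1) ^ 2 := by
      rw [← sq_abs, hj]; positivity
    linarith [sq_nonneg (1 - radius y)]

/-- The vector of `ℝⁿ` with the coordinates of the collapse. With `u = 2y - 1` and `b = 1 - ‖u‖`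
(maximum norm), it is the image of `u / b ∈ ℝ^(n-1)` under the inverse stereographic projection
from the first basis vector, extended to `b = 0`. -/
def collapseFun (y : Rest n → I) : EuclideanSpace ℝ (Fin n) :=
  WithLp.toLp 2 fun j =>
    if h : j = 0 then (∑ k, (2 * (y k : ℝ) - 1) ^ 2 - (1 - radius y) ^ 2) / collapseDenom y
    else 2 * (1 - radius y) * (2 * (y ⟨j, h⟩ : ℝ) - 1) / collapseDenom y

theorem one_sub_radius_nonneg (y : Rest n → I) : 0 ≤ 1 - radius y := by
  linarith [radius_le_one y]

theorem collapseFun_zero (y : Rest n → I) : collapseFun y 0 =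
    (∑ k, (2 * (y k : ℝ) - 1) ^ 2 - (1 - radius y) ^ 2) / collapseDenom y := by
  simp [collapseFun]

theorem collapseFun_rest (y : Rest n → I) (j : Rest n) : collapseFun y j =
    2 * (1 - radius y) * (2 * (y j : ℝ) - 1) / collapseDenom y := by
  simp [collapseFun, j.2]

theorem sum_fin_eq (f : Fin n → ℝ) : ∑ j, f j = f 0 + ∑ j : Rest n, f j := by
  exact Fintype.sum_eq_add_sum_subtype_ne f 0

theorem collapseFun_mem (y : Rest n → I) :
    collapseFun y ∈ Metric.sphere (0 : EuclideanSpace ℝ (Fin n)) 1 := by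
  have hD := (collapseDenom_pos y).ne'
  rw [EuclideanSpace.sphere_zero_eq _ zero_le_one, Set.mem_ofPred_eq, sum_fin_eq,
    collapseFun_zero]
  simp_rw [collapseFun_rest, div_pow, mul_pow, ← Finset.sum_div, ← Finset.mul_sum]
  rw [← add_div, div_eq_iff (pow_ne_zero 2 hD), collapseDenom]
  ring

/-- The map `[0,1]^(n-1) → S^(n-1)` that collapses the boundary of the cube to the first basis
vector and is injective on the interior. -/
def collapse (n : ℕ) [n.AtLeastTwo] : C(Rest n → I, Sphere n) where
  toFun y := ⟨collapseFun y, collapseFun_mem y⟩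
  continuous_toFun := by
    have hr : Continuous (radius : (Rest n → I) → ℝ) := continuous_radius
    have hD : Continuous (collapseDenom : (Rest n → I) → ℝ) := by
      unfold collapseDenom; fun_prop
    refine Continuous.subtype_mk ((PiLp.continuous_toLp 2 _).comp (continuous_pi fun j => ?_)) _
    by_cases h : j = 0
    · simp only [h, dite_true]
      exact Continuous.div (by fun_prop) hD fun y => (collapseDenom_pos y).ne'
    · simp only [h, dite_false]
      exact Continuous.div (by fun_prop) hD fun y => (collapseDenom_pos y).ne'

/-- The first basis vector of `ℝⁿ`, the base point of `S^(n-1)`. -/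
def pole (n : ℕ) [n.AtLeastTwo] : Sphere n := ⟨EuclideanSpace.single 0 1, by simp⟩

theorem sphere_sum (p : Sphere n) : (p.1 0) ^ 2 + ∑ j : Rest n, (p.1 j) ^ 2 = 1 := by
  obtain ⟨v, hv⟩ := p
  rw [EuclideanSpace.sphere_zero_eq _ zero_le_one, Set.mem_ofPred_eq, sum_fin_eq] at hv
  simpa using hv

theorem sphere_ext {p q : Sphere n} (h0 : p.1 0 = q.1 0) (h : ∀ j : Rest n, p.1 j = q.1 j) :
    p = q := by
  apply Subtype.ext; ext j
  by_cases hj : j = 0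
  · rw [hj, h0]
  · exact h ⟨j, hj⟩

theorem collapse_zero (y : Rest n → I) : (collapse n y).1 0 =
    (∑ k, (2 * (y k : ℝ) - 1) ^ 2 - (1 - radius y) ^ 2) / collapseDenom y := collapseFun_zero y

theorem collapse_rest (y : Rest n → I) (j : Rest n) : (collapse n y).1 j =
    2 * (1 - radius y) * (2 * (y j : ℝ) - 1) / collapseDenom y := collapseFun_rest y j

theorem one_sub_collapse_zero (y : Rest n → I) :
    1 - (collapse n y).1 0 = 2 * (1 - radius y) ^ 2 / collapseDenom y := by
  have hD := (collapseDenom_pos y).ne'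
  rw [collapse_zero, eq_div_iff hD, sub_mul, div_mul_cancel₀ _ hD, collapseDenom]
  ring

/-- The boundary of the cube goes to the base point of the sphere, the interior does not. -/
theorem collapse_eq_pole_iff (y : Rest n → I) :
    collapse n y = pole n ↔ y ∈ Cube.boundary (Rest n) := by
  rw [← radius_eq_one_iff]
  have hD := (collapseDenom_pos y).ne'
  constructor
  · intro h
    have h1 := one_sub_collapse_zero y
    rw [h] at h1
    have h2 : (pole n).1 0 = 1 := by simp [pole]
    rw [h2, sub_self, eq_comm, div_eq_zero_iff] at h1
    have h3 : (1 - radius y) ^ 2 = 0 := by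
      rcases h1 with h1 | h1
      · linarith
      · exact absurd h1 hD
    have := pow_eq_zero_iff (two_ne_zero) |>.1 h3
    linarith
  · intro h
    apply sphere_ext
    · have h1 := one_sub_collapse_zero y
      have h2 : (pole n).1 0 = 1 := by simp [pole]
      rw [h] at h1
      norm_num at h1
      linarith
    · intro j
      rw [collapse_rest, h]
      simp [pole, j.2]

theorem collapse_eq_iff (y y' : Rest n → I) : collapse n y = collapse n y' ↔
    y = y' ∨ (y ∈ Cube.boundary (Rest n) ∧ y' ∈ Cube.boundary (Rest n)) := by
  constructor
  · intro h
    by_cases hy : y ∈ Cube.boundary (Rest n)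
    · right
      exact ⟨hy, (collapse_eq_pole_iff y').1 (h ▸ (collapse_eq_pole_iff y).2 hy)⟩
    have hy' : y' ∉ Cube.boundary (Rest n) := fun h' =>
      hy ((collapse_eq_pole_iff y).1 (h.trans ((collapse_eq_pole_iff y').2 h')))
    left
    rw [← radius_eq_one_iff] at hy hy'
    have hb : 0 < 1 - radius y :=
      lt_of_le_of_ne (one_sub_radius_nonneg y) fun h => hy (by linarith)
    have hb' : 0 < 1 - radius y' :=
      lt_of_le_of_ne (one_sub_radius_nonneg y') fun h => hy' (by linarith)
    have hD := collapseDenom_pos y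
    have hD' := collapseDenom_pos y'
    -- the stereographic coordinates `u / b` agree
    have key : ∀ j, (2 * (y j : ℝ) - 1) / (1 - radius y) =
        (2 * (y' j : ℝ) - 1) / (1 - radius y') := by
      intro j
      have e : ∀ z : Rest n → I, 0 < 1 - radius z → (2 * (z j : ℝ) - 1) / (1 - radius z) =
          (collapse n z).1 j / (1 - (collapse n z).1 0) := by
        intro z hz
        have hDz := collapseDenom_pos z
        rw [one_sub_collapse_zero, collapse_rest]
        field_simp
      rw [e y hb, e y' hb', h]
    have hle : ∀ z z' : Rest n → I, 0 < 1 - radius z → 0 < 1 - radius z' →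
        (∀ j, (2 * (z j : ℝ) - 1) / (1 - radius z) = (2 * (z' j : ℝ) - 1) / (1 - radius z')) →
        radius z ≤ radius z' := by
      intro z z' hz hz' hk
      have : radius z ≤ radius z' * (1 - radius z) / (1 - radius z') := by
        refine (pi_norm_le_iff_of_nonneg (by have := radius_nonneg z'; positivity)).2 fun j => ?_
        have h1 : 2 * (z j : ℝ) - 1 = (2 * (z' j : ℝ) - 1) * ((1 - radius z) / (1 - radius z')) := by
          have := hk j
          field_simp at this ⊢
          linarith
        rw [Real.norm_eq_abs, h1, abs_mul, abs_of_pos (div_pos hz hz'), ← mul_div_assoc]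
        have := abs_le_radius z' j
        gcongr
      rw [le_div_iff₀ hz'] at this
      linarith
    have hrr : radius y = radius y' :=
      le_antisymm (hle y y' hb hb' key) (hle y' y hb' hb fun j => (key j).symm)
    funext j
    have := key j
    rw [hrr, div_left_inj' hb'.ne'] at this
    apply Subtype.ext
    linarith
  · rintro (rfl | ⟨h, h'⟩)
    · rfl
    · rw [(collapse_eq_pole_iff y).2 h, (collapse_eq_pole_iff y').2 h']

theorem collapse_surjective : Function.Surjective (collapse n) := by
  intro p
  by_cases hp : p.1 0 = 1
  · have : Nonempty (Rest n) := let ⟨j, hj⟩ := exists_ne (0 : Fin n); ⟨⟨j, hj⟩⟩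
    refine ⟨fun _ => 0, ?_⟩
    rw [(collapse_eq_pole_iff _).2 ⟨Classical.arbitrary _, Or.inl rfl⟩]
    have hs := sphere_sum p
    rw [hp] at hs
    have hz : ∑ j : Rest n, (p.1 j) ^ 2 = 0 := by linarith
    rw [Finset.sum_eq_zero_iff_of_nonneg fun _ _ => sq_nonneg _] at hz
    apply sphere_ext
    · rw [hp]; simp [pole]
    · intro j
      rw [pow_eq_zero_iff two_ne_zero |>.1 (hz j (Finset.mem_univ j))]
      simp [pole, j.2]
  · set M : ℝ := ‖fun j : Rest n => p.1 j‖ with hM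
    have hs := sphere_sum p
    have hsum : 0 ≤ ∑ j : Rest n, (p.1 j) ^ 2 := Finset.sum_nonneg fun _ _ => sq_nonneg _
    have hc : 0 < 1 - p.1 0 :=
      lt_of_le_of_ne (by nlinarith) fun h => hp (by linarith)
    have hM0 : 0 ≤ M := norm_nonneg _
    have hE : 0 < 1 - p.1 0 + M := by linarith
    have hj : ∀ j : Rest n, |p.1 j / (1 - p.1 0 + M)| ≤ 1 := by
      intro j
      rw [abs_div, abs_of_pos hE, div_le_one hE]
      have : |p.1 j| ≤ M := norm_le_pi_norm (fun j : Rest n => p.1 j) j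
      linarith
    let y : Rest n → I := fun j => ⟨(1 + p.1 j / (1 - p.1 0 + M)) / 2, by
      have := abs_le.1 (hj j); constructor <;> linarith⟩
    have hu : ∀ j, 2 * (y j : ℝ) - 1 = p.1 j / (1 - p.1 0 + M) := by
      intro j; simp only [y]; ring
    have hr : radius y = M / (1 - p.1 0 + M) := by
      have : (fun j => 2 * (y j : ℝ) - 1) =
          (1 - p.1 0 + M)⁻¹ • fun j : Rest n => p.1 j := by
        funext j; rw [hu]; simp [div_eq_inv_mul]
      rw [radius, this, norm_smul, norm_inv, Real.norm_eq_abs, abs_of_pos hE, ← hM]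
      field_simp
    have hb : 1 - radius y = (1 - p.1 0) / (1 - p.1 0 + M) := by
      rw [hr]; field_simp; ring
    have hS : ∑ j, (2 * (y j : ℝ) - 1) ^ 2 = (1 - (p.1 0) ^ 2) / (1 - p.1 0 + M) ^ 2 := by
      simp_rw [hu, div_pow, ← Finset.sum_div]
      rw [eq_sub_of_add_eq' hs]
    have hD : collapseDenom y = 2 * (1 - p.1 0) / (1 - p.1 0 + M) ^ 2 := by
      rw [collapseDenom, hS, hb]; field_simp; ring
    refine ⟨y, sphere_ext ?_ fun j => ?_⟩
    · rw [collapse_zero, hS, hb, hD]; field_simp; ring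
    · rw [collapse_rest, hu, hb, hD]; field_simp

end Collapse

/-! ### The inclusion of `π_n` into the Abe group -/

section PiN

variable [n.AtLeastTwo]

/-- The collapse `[0,1] × [0,1]^(n-1) → [0,1] × S^(n-1)` of the sides of the cylinder. -/
def cylinderCollapse (n : ℕ) [n.AtLeastTwo] : C(I × (Rest n → I), I × Sphere n) :=
  (ContinuousMap.id I).prodMap (collapse n)

theorem cylinderCollapse_apply (t : I) (y : Rest n → I) :
    cylinderCollapse n (t, y) = (t, collapse n y) := rfl

theorem isQuotientMap_cylinderCollapse : Topology.IsQuotientMap (cylinderCollapse n) :=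
  (cylinderCollapse n).continuous.isClosedMap.isQuotientMap (cylinderCollapse n).continuous
    (Function.surjective_id.prodMap collapse_surjective)

theorem isQuotientMap_id_prod_cylinderCollapse :
    Topology.IsQuotientMap ((ContinuousMap.id I).prodMap (cylinderCollapse n)) :=
  (map_continuous _).isClosedMap.isQuotientMap (map_continuous _)
    (Function.surjective_id.prodMap isQuotientMap_cylinderCollapse.surjective)

/-- Two points of the cube with the same image in `[0,1] × S^(n-1)` are equal or both on the
boundary. -/
theorem insertAt_eq_or_boundary {z z' : I × (Rest n → I)}
    (h : cylinderCollapse n z = cylinderCollapse n z') :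
    z = z' ∨ (Cube.insertAt (0 : Fin n) z ∈ Cube.boundary (Fin n) ∧
      Cube.insertAt (0 : Fin n) z' ∈ Cube.boundary (Fin n)) := by
  obtain ⟨t, y⟩ := z
  obtain ⟨t', y'⟩ := z'
  rw [cylinderCollapse_apply, cylinderCollapse_apply, Prod.mk.injEq, collapse_eq_iff] at h
  obtain ⟨rfl, rfl | ⟨h, h'⟩⟩ := h
  · exact Or.inl rfl
  · exact Or.inr ⟨Cube.insertAt_boundary 0 (Or.inr h), Cube.insertAt_boundary 0 (Or.inr h')⟩

theorem factorsThrough_cylinderCollapse (f : GenLoop (Fin n) X x) :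
    Function.FactorsThrough (f.1.comp (Cube.insertAt (0 : Fin n) : C(I × (Rest n → I), I^(Fin n))))
      (cylinderCollapse n) := by
  intro z z' h
  rcases insertAt_eq_or_boundary h with rfl | ⟨h, h'⟩
  · rfl
  · exact (f.2 _ h).trans (f.2 _ h').symm

/-- The map of the cylinder that becomes the map `f` of the `n`-cube when composed with the
collapse. The first coordinate of the cube is the coordinate of `[0,1]`, and `S^(n-1)` is the cube
of the other coordinates with its boundary collapsed. -/
def liftGenLoop (f : GenLoop (Fin n) X x) : C(I × Sphere n, X) :=
  isQuotientMap_cylinderCollapse.lift _ (factorsThrough_cylinderCollapse f)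

theorem liftGenLoop_apply (f : GenLoop (Fin n) X x) (t : I) (y : Rest n → I) :
    liftGenLoop f (t, collapse n y) = f (Cube.insertAt (0 : Fin n) (t, y)) :=
  DFunLike.congr_fun (isQuotientMap_cylinderCollapse.lift_comp _
    (factorsThrough_cylinderCollapse f)) (t, y)

/-- A map `f` of the `n`-cube sending the boundary to `x`, seen as a map of the cylinder
`[0,1] × S^(n-1)`. -/
def ofGenLoop (f : GenLoop (Fin n) X x) : AbeLoop n X x :=
  ⟨liftGenLoop f, by
    rintro ⟨t, p⟩ ht
    obtain ⟨y, rfl⟩ := collapse_surjective p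
    exact (liftGenLoop_apply f t y).trans (f.2 _ (Cube.insertAt_boundary 0 (Or.inl ht)))⟩

theorem ofGenLoop_apply (f : GenLoop (Fin n) X x) (t : I) (y : Rest n → I) :
    (ofGenLoop f).1 (t, collapse n y) = f (Cube.insertAt (0 : Fin n) (t, y)) :=
  liftGenLoop_apply f t y

theorem ofGenLoop_homotopic {f g : GenLoop (Fin n) X x} (h : GenLoop.Homotopic f g) :
    (ofGenLoop f).1.HomotopicRel (ofGenLoop g).1 (cylinderEnds n) := by
  obtain ⟨H⟩ := h
  let K : C(I × (I × (Rest n → I)), X) := H.toContinuousMap.comp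
    ((ContinuousMap.id I).prodMap (Cube.insertAt (0 : Fin n) : C(_, _)))
  have hK : Function.FactorsThrough K ((ContinuousMap.id I).prodMap (cylinderCollapse n)) := by
    rintro ⟨τ, z⟩ ⟨τ', z'⟩ h
    have hτ : τ = τ' := congrArg Prod.fst h
    subst hτ
    replace h : cylinderCollapse n z = cylinderCollapse n z' := congrArg Prod.snd h
    rcases insertAt_eq_or_boundary (z := z) (z' := z') h with rfl | ⟨h, h'⟩
    · rfl
    · exact ((H.eq_fst τ h).trans (f.2 _ h)).trans ((H.eq_fst τ h').trans (f.2 _ h')).symm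
  have hL : ∀ τ t y, isQuotientMap_id_prod_cylinderCollapse.lift K hK (τ, (t, collapse n y)) =
      H (τ, Cube.insertAt (0 : Fin n) (t, y)) := fun τ t y =>
    DFunLike.congr_fun (isQuotientMap_id_prod_cylinderCollapse.lift_comp K hK) (τ, (t, y))
  refine ⟨⟨⟨isQuotientMap_id_prod_cylinderCollapse.lift K hK, ?_, ?_⟩, ?_⟩⟩
  · rintro ⟨t, p⟩
    obtain ⟨y, rfl⟩ := collapse_surjective p
    exact (hL 0 t y).trans ((H.apply_zero _).trans (ofGenLoop_apply f t y).symm)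
  · rintro ⟨t, p⟩
    obtain ⟨y, rfl⟩ := collapse_surjective p
    exact (hL 1 t y).trans ((H.apply_one _).trans (ofGenLoop_apply g t y).symm)
  · rintro τ ⟨t, p⟩ ht
    obtain ⟨y, rfl⟩ := collapse_surjective p
    refine (hL τ t y).trans ((H.eq_fst τ ?_).trans (ofGenLoop_apply f t y).symm)
    exact Cube.insertAt_boundary 0 (Or.inl ht)

/-- The map `π_n(X, x) → κ_n(X, x)` induced by the map from the cylinder to the sphere
`S^n = [0,1]^n / ∂[0,1]^n`. -/
def ofPiN (n : ℕ) [n.AtLeastTwo] : π_ n X x → AbeGroup n X x :=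
  Quotient.map ofGenLoop fun _ _ h => ofGenLoop_homotopic h

end PiN

/-! ### The action of `π₁` on `π_n` -/

section Action

/-- The map `[0,1]^n → [0,1]^n` that expands the concentric cube of half the size to the whole
cube. -/
def expand (y : Fin n → I) : Fin n → I :=
  fun j => Set.projIcc 0 1 zero_le_one (2 * (y j : ℝ) - 1 / 2)

theorem continuous_expand : Continuous (expand : (Fin n → I) → Fin n → I) := by
  unfold expand; fun_prop

theorem expand_mem_boundary {y : Fin n → I} (h : radius y = 1 / 2) :
    expand y ∈ Cube.boundary (Fin n) := by
  obtain ⟨j, hj⟩ := exists_abs_eq_radius y (by rw [h]; norm_num)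
  refine ⟨j, ?_⟩
  rw [h] at hj
  rcases (abs_eq (by norm_num)).1 hj with h' | h'
  · right
    exact Set.projIcc_of_right_le _ (by linarith)
  · left
    exact Set.projIcc_of_le_left _ (by linarith)

/-- For maps `F(z, -)` of the cube that are constant on its boundary and paths `L(z, -)` that
start at the value there: the maps that are a copy of `F(z, -)` on the concentric cube of half the
size, surrounded by `L(z, -)` along each ray from the centre. -/
def collar {Z : Type*} [TopologicalSpace Z] (F : C(Z × (Fin n → I), X)) (L : C(Z × I, X))
    (h : ∀ z, ∀ y ∈ Cube.boundary (Fin n), F (z, y) = L (z, 0)) : C(Z × (Fin n → I), X) where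
  toFun w := if radius w.2 ≤ 1 / 2 then F (w.1, expand w.2)
    else L (w.1, Set.projIcc 0 1 zero_le_one (2 * radius w.2 - 1))
  continuous_toFun := by
    have hr : Continuous (radius : (Fin n → I) → ℝ) := continuous_radius
    have he : Continuous (expand : (Fin n → I) → Fin n → I) := continuous_expand
    refine Continuous.if_le (by fun_prop) (by fun_prop) (by fun_prop) continuous_const ?_
    intro w hw
    rw [h _ _ (expand_mem_boundary hw), hw, Set.projIcc_of_le_left _ (by norm_num)]
    rfl

theorem collar_boundary {Z : Type*} [TopologicalSpace Z] (F : C(Z × (Fin n → I), X))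
    (L : C(Z × I, X)) (h : ∀ z, ∀ y ∈ Cube.boundary (Fin n), F (z, y) = L (z, 0)) (z : Z)
    {y : Fin n → I} (hy : y ∈ Cube.boundary (Fin n)) : collar F L h (z, y) = L (z, 1) := by
  have hr := (radius_eq_one_iff y).2 hy
  change (if radius y ≤ 1 / 2 then _ else _) = _
  rw [if_neg (by rw [hr]; norm_num), hr, Set.projIcc_of_right_le _ (by norm_num)]
  rfl

/-- The loop `l` acting on the map `f` of the cube: a copy of `f` on the concentric cube of half
the size, with values `l` along each ray from there to the boundary. -/
def actLoop (l : Path x x) (f : GenLoop (Fin n) X x) : GenLoop (Fin n) X x :=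
  ⟨(collar (Z := Unit) (f.1.comp ⟨Prod.snd, continuous_snd⟩)
      (l.toContinuousMap.comp ⟨Prod.snd, continuous_snd⟩)
      (fun _ y hy => (f.2 y hy).trans l.source.symm)).comp ⟨fun y => ((), y), by fun_prop⟩,
    fun _ hy => (collar_boundary _ _ (fun _ y hy => (f.2 y hy).trans l.source.symm) () hy).trans
      l.target⟩

theorem actLoop_apply (l : Path x x) (f : GenLoop (Fin n) X x) (y : Fin n → I) :
    actLoop l f y = if radius y ≤ 1 / 2 then f (expand y)
      else l (Set.projIcc 0 1 zero_le_one (2 * radius y - 1)) := rfl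

theorem actLoop_homotopic {l l' : Path x x} (hl : l.Homotopic l') {f f' : GenLoop (Fin n) X x}
    (hf : GenLoop.Homotopic f f') : GenLoop.Homotopic (actLoop l f) (actLoop l' f') := by
  obtain ⟨L⟩ := hl
  obtain ⟨H⟩ := hf
  have hHL : ∀ τ, ∀ y ∈ Cube.boundary (Fin n),
      H.toContinuousMap (τ, y) = L.toContinuousMap (τ, 0) := fun τ y hy =>
    (H.eq_fst τ hy).trans ((f.2 y hy).trans (L.source τ).symm)
  refine ⟨⟨⟨collar H.toContinuousMap L.toContinuousMap hHL, ?_, ?_⟩, ?_⟩⟩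
  · intro y
    change (if radius y ≤ 1 / 2 then H (0, expand y) else L (0, _)) = actLoop l f y
    rw [actLoop_apply, H.apply_zero, L.apply_zero]
    rfl
  · intro y
    change (if radius y ≤ 1 / 2 then H (1, expand y) else L (1, _)) = actLoop l' f' y
    rw [actLoop_apply, H.apply_one, L.apply_one]
    rfl
  · intro τ y hy
    refine (collar_boundary _ _ hHL τ hy).trans ((L.target τ).trans ?_)
    exact ((actLoop l f).2 y hy).symm

/-- The action of `π₁(X, x)` on `π_n(X, x)`. -/
def act : FundamentalGroup X x → π_ n X x → π_ n X x :=
  Quotient.map₂ actLoop fun _ _ hl _ _ hf => actLoop_homotopic hl hf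

/-- `X` is `n`-simple (at the base point `x`): `π₁(X, x)` acts trivially on `π_n(X, x)`. -/
def IsSimple (n : ℕ) (X : Type*) [TopologicalSpace X] (x : X) : Prop :=
  ∀ (γ : FundamentalGroup X x) (α : π_ n X x), act γ α = α

end Action

/-! ### The influence of vortices -/

/-- A topological excitation `f` becomes `g` when it is carried around the loop `l`: there is a
continuous family of maps of the cube from `f` to `g`, the map at time `t` being based at `l t`. -/
def CarriedAround (l : Path x x) (f g : GenLoop (Fin n) X x) : Prop :=
  ∃ H : C(I × (Fin n → I), X), (∀ y, H (0, y) = f y) ∧ (∀ y, H (1, y) = g y) ∧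
    ∀ t, ∀ y ∈ Cube.boundary (Fin n), H (t, y) = l t

/-- Vortices influence the excitations of dimension `n`: the class in `π_n(X, x)` of some
excitation changes when the excitation is carried around some loop. -/
def VorticesInfluence (n : ℕ) (X : Type*) [TopologicalSpace X] (x : X) : Prop :=
  ∃ (l : Path x x) (f g : GenLoop (Fin n) X x),
    CarriedAround l f g ∧ (⟦f⟧ : π_ n X x) ≠ ⟦g⟧

end AbeHomotopy

end

open scoped unitInterval Topology

noncomputable section

/-! The group κ_n is the fundamental group of the space of maps S^(n-1) → X at the constant map.
Evaluation at the pole of the sphere gives a homomorphism κ_n → π₁ (`AbeGroup.side`), split by ι_*.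
Its kernel is the image of π_n, and π_n embeds, so there is always a split exact sequence 1 → π_n →
κ_n → π₁ → 1 and κ_n is always a semidirect product, with π₁ acting by conjugation
(`SemidirectProduct.exists_mulEquiv_of_retraction`). Injectivity and exactness (`ofPiN_injective`,
`range_ofPiNHom`) come from one construction, `squeeze`: multiply a map of the cylinder by the
inverse of its side, then contract the resulting path-and-back over the boundary of the cube.

What remains is to recognise the conjugation. A family carrying f to g around l is a square in the
mapping space with edges f, l, l, g, and its two ways around give l · f = g · l in κ_n
(`CarriedAround.ofPiOne_mul_ofPiN`). Growing f inward shows that the geometric action is itself such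
a carrying (`carriedAround_actLoop`). Hence each of the four statements says that conjugation of π_n
by π₁ in κ_n is nontrivial. -/

/-- A group with a retraction onto `P` whose kernel is `N` is the semidirect product of `N` and
`P`, for the action by conjugation. -/
theorem SemidirectProduct.exists_mulEquiv_of_retraction {K N P : Type*} [Group K] [Group N]
    [Group P] (j : N →* K) (i : P →* K) (r : K →* P) (hj : Function.Injective j)
    (hri : ∀ γ, r (i γ) = γ) (hker : j.range = r.ker) :
    ∃ (φ : P →* MulAut N) (e : K ≃* N ⋊[φ] P), (∀ α, e (j α) = SemidirectProduct.inl α) ∧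
      (∀ γ, e (i γ) = SemidirectProduct.inr γ) ∧
      ∀ γ α, j (φ γ α) = i γ * j α * (i γ)⁻¹ := by
  have hmem (α : N) : r (j α) = 1 := by
    rw [← MonoidHom.mem_ker, ← hker]; exact ⟨α, rfl⟩
  -- The kernel is normal, so conjugation by `i γ` acts on it; `j'` transports this action to `N`.
  let j' : N ≃* r.ker := (MonoidHom.ofInjective hj).trans (MulEquiv.subgroupCongr hker)
  have hj' (α : N) : (j' α : K) = j α := rfl
  let φ : P →* MulAut N :=
    ((MulAut.congr j'.symm).toMonoidHom.comp (MulAut.conjNormal (H := r.ker))).comp i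
  have hφ (γ : P) (α : N) : j (φ γ α) = i γ * j α * (i γ)⁻¹ := by
    change j (j'.symm (MulAut.conjNormal (i γ) (j' α))) = _
    rw [← hj', MulEquiv.apply_symm_apply, MulAut.conjNormal_apply, hj']
  let f : N ⋊[φ] P →* K := SemidirectProduct.lift j i fun γ => by
    ext α; simp [hφ]
  have hf : Function.Bijective f := by
    constructor
    · rw [injective_iff_map_eq_one]
      intro w hw
      have hw' : j w.left * i w.right = 1 := hw
      have h1 : w.right = 1 := by
        have := congrArg r hw'
        rwa [map_mul, hmem, one_mul, hri, map_one] at this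
      have h2 : w.left = 1 := hj (by rw [map_one, ← hw', h1, map_one, mul_one])
      exact SemidirectProduct.ext h2 h1
    · intro k
      -- Dividing `k` by the lift of its retraction leaves an element of the kernel.
      have hk : k * (i (r k))⁻¹ ∈ j.range := by
        rw [hker, MonoidHom.mem_ker, map_mul, map_inv, hri, mul_inv_cancel]
      obtain ⟨α, hα⟩ := hk
      refine ⟨⟨α, r k⟩, ?_⟩
      change j α * i (r k) = k
      rw [hα, inv_mul_cancel_right]
  let e := (MulEquiv.ofBijective f hf).symm
  refine ⟨φ, e, fun α => ?_, fun γ => ?_, hφ⟩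
  · rw [MulEquiv.symm_apply_eq]; simp [f]
  · rw [MulEquiv.symm_apply_eq]; simp [f]

/-! ### The inclusion of π₁ and its retraction -/

namespace AbeHomotopy

variable {X : Type*} [TopologicalSpace X] {x : X} {n : ℕ}

/-- Concatenation affects only the coordinate t, so the representatives agree exactly and no
homotopy is needed. -/
theorem ofPiOne_mul (γ γ' : FundamentalGroup X x) :
    ofPiOne n (γ * γ') = ofPiOne n γ * ofPiOne n γ' := by
  induction γ using Quotient.inductionOn with | h l => ?_
  induction γ' using Quotient.inductionOn with | h l' => ?_
  change AbeGroup.mk (ofLoop n (l'.trans l)) = AbeGroup.mk (ofLoop n l) * AbeGroup.mk (ofLoop n l')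
  rw [AbeGroup.mk_mul_mk]
  congr 1
  apply AbeLoop.equivPath.injective
  rw [AbeLoop.trans, Equiv.apply_symm_apply]
  ext t p
  change (l'.trans l) t = (AbeLoop.equivPath (ofLoop n l')).trans (AbeLoop.equivPath (ofLoop n l)) t p
  rw [Path.trans_apply, Path.trans_apply]
  split_ifs <;> rfl

/-- The loop of the values of a map of the cylinder over a point of the sphere. -/
def AbeLoop.side (F : AbeLoop n X x) (p : Sphere n) : Path x x where
  toFun t := F.1 (t, p)
  continuous_toFun := by fun_prop
  source' := F.2 (0, p) (Or.inl rfl)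
  target' := F.2 (1, p) (Or.inr rfl)

theorem AbeLoop.side_trans (F G : AbeLoop n X x) (p : Sphere n) :
    (F.trans G).side p = (F.side p).trans (G.side p) := by
  ext t
  change ((equivPath F).trans (equivPath G)) t p = _
  rw [Path.trans_apply, Path.trans_apply]
  split_ifs <;> rfl

theorem AbeLoop.side_homotopic {F G : AbeLoop n X x} (h : F.1.HomotopicRel G.1 (cylinderEnds n))
    (p : Sphere n) : (F.side p).Homotopic (G.side p) := by
  obtain ⟨H⟩ := h
  refine ⟨⟨⟨H.toContinuousMap.comp ⟨fun z => (z.1, (z.2, p)), by fun_prop⟩, ?_, ?_⟩, ?_⟩⟩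
  · exact fun t => H.apply_zero (t, p)
  · exact fun t => H.apply_one (t, p)
  · exact fun τ t ht => H.eq_fst τ (x := (t, p)) ht

/-- The homomorphism `κ_n(X, x) → π₁(X, x)` given by the values over a point of the sphere. -/
def AbeGroup.side (p : Sphere n) : AbeGroup n X x →* FundamentalGroup X x :=
  MonoidHom.mk' (Quotient.map (fun F => F.side p) fun _ _ h => AbeLoop.side_homotopic h p) (by
    intro a b
    induction a using Quotient.inductionOn with | h F => ?_
    induction b using Quotient.inductionOn with | h G => ?_
    change Quotient.map _ _ (mk F * mk G) = _
    rw [mk_mul_mk]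
    change Path.Homotopic.Quotient.mk ((G.trans F).side p) = _
    rw [AbeLoop.side_trans]
    rfl)

theorem AbeGroup.side_ofPiOne (p : Sphere n) (γ : FundamentalGroup X x) :
    side p (ofPiOne n γ) = γ := by
  induction γ using Quotient.inductionOn with | h l => rfl

/-! ### The inclusion of π_n is a homomorphism into the kernel of the side map -/

section

variable [n.AtLeastTwo]

open GenLoop in
theorem ofGenLoop_transAt (f g : GenLoop (Fin n) X x) :
    ofGenLoop (transAt 0 f g) = (ofGenLoop f).trans (ofGenLoop g) := by
  apply Subtype.ext
  ext ⟨t, p⟩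
  obtain ⟨y, rfl⟩ := collapse_surjective p
  have key (s : I) : Function.update (Cube.insertAt (0 : Fin n) (t, y)) 0 s =
      Cube.insertAt (0 : Fin n) (s, y) := by
    funext k
    by_cases hk : k = 0
    · subst hk; simp
    · simp [hk]
  have h0 : Cube.insertAt (0 : Fin n) (t, y) 0 = t := by simp
  rw [AbeLoop.trans_apply, ofGenLoop_apply, transAt, coe_copy, h0]
  simp only [key, ofGenLoop_apply]

theorem ofPiN_mul (α β : π_ n X x) : ofPiN n (α * β) = ofPiN n α * ofPiN n β := by
  obtain ⟨f, rfl⟩ := Quotient.exists_rep α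
  obtain ⟨g, rfl⟩ := Quotient.exists_rep β
  -- The product of π_n can be computed by concatenation in any coordinate; coordinate 0 is the one
  -- that becomes t on the cylinder.
  refine (congrArg (ofPiN n) (HomotopyGroup.mul_spec (i := 0))).trans ?_
  change AbeGroup.mk (ofGenLoop _) = AbeGroup.mk (ofGenLoop f) * AbeGroup.mk (ofGenLoop g)
  rw [ofGenLoop_transAt, AbeGroup.mk_mul_mk]

theorem collapse_zero_eq_pole : collapse n (fun _ => 0) = pole n := by
  -- This is where n ≥ 2 enters: the cube of the remaining coordinates must have a nonempty
  -- boundary.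
  have : Nonempty (Rest n) := let ⟨j, hj⟩ := exists_ne (0 : Fin n); ⟨⟨j, hj⟩⟩
  exact (collapse_eq_pole_iff _).2 ⟨Classical.arbitrary _, Or.inl rfl⟩

theorem ofGenLoop_pole (f : GenLoop (Fin n) X x) (t : I) : (ofGenLoop f).1 (t, pole n) = x := by
  have hb := (collapse_eq_pole_iff (n := n) _).1 collapse_zero_eq_pole
  rw [← collapse_zero_eq_pole, ofGenLoop_apply]
  exact f.2 _ (Cube.insertAt_boundary 0 (Or.inr hb))

theorem AbeGroup.side_ofPiN (α : π_ n X x) : side (pole n) (ofPiN n α) = 1 := by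
  induction α using Quotient.inductionOn with | h f => ?_
  change Path.Homotopic.Quotient.mk ((ofGenLoop f).side (pole n)) = _
  have : (ofGenLoop f).side (pole n) = Path.refl x := by
    ext t; exact ofGenLoop_pole f t
  rw [this]
  rfl

/-! ### Carrying around a loop is conjugation -/

theorem factorsThrough_of_boundary {K : C(I × (I × (Rest n → I)), X)}
    (hK : ∀ τ t, ∀ y ∈ Cube.boundary (Rest n), ∀ y' ∈ Cube.boundary (Rest n),
      K (τ, (t, y)) = K (τ, (t, y'))) :
    Function.FactorsThrough K ((ContinuousMap.id I).prodMap (cylinderCollapse n)) := by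
  rintro ⟨τ, t, y⟩ ⟨τ', t', y'⟩ h
  obtain ⟨rfl, h⟩ := Prod.ext_iff.1 h
  obtain ⟨rfl, h⟩ := Prod.ext_iff.1 h
  rcases (collapse_eq_iff y y').1 h with rfl | ⟨h, h'⟩
  · rfl
  · exact hK τ t y h y' h'

/-- A family of maps of `[0,1] × [0,1]^(n-1)`, each depending only on the first coordinate over the
boundary of `[0,1]^(n-1)`, seen as a family of maps of the cylinder. -/
def liftFamily (K : C(I × (I × (Rest n → I)), X))
    (hK : ∀ τ t, ∀ y ∈ Cube.boundary (Rest n), ∀ y' ∈ Cube.boundary (Rest n),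
      K (τ, (t, y)) = K (τ, (t, y'))) : C(I × (I × Sphere n), X) :=
  isQuotientMap_id_prod_cylinderCollapse.lift K (factorsThrough_of_boundary hK)

theorem liftFamily_apply (K : C(I × (I × (Rest n → I)), X))
    (hK : ∀ τ t, ∀ y ∈ Cube.boundary (Rest n), ∀ y' ∈ Cube.boundary (Rest n),
      K (τ, (t, y)) = K (τ, (t, y'))) (τ t : I) (y : Rest n → I) :
    liftFamily K hK (τ, (t, collapse n y)) = K (τ, (t, y)) :=
  DFunLike.congr_fun (isQuotientMap_id_prod_cylinderCollapse.lift_comp K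
    (factorsThrough_of_boundary hK)) (τ, (t, y))

/-- The two ways around a square are homotopic. -/
theorem _root_.Path.Homotopic.of_square {Y : Type*} [TopologicalSpace Y] {y : Y}
    (Q : C(I × I, Y)) {a b c d : Path y y} (ha : ∀ t, Q (0, t) = a t) (hb : ∀ s, Q (s, 1) = b s)
    (hc : ∀ s, Q (s, 0) = c s) (hd : ∀ t, Q (1, t) = d t) :
    (a.trans b).Homotopic (c.trans d) := by
  let i : Path (0 : I) 1 := ⟨⟨id, continuous_id⟩, rfl, rfl⟩
  let p : Path ((0, 0) : I × I) (1, 1) := ((Path.refl 0).prod i).trans (i.prod (Path.refl 1))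
  let q : Path ((0, 0) : I × I) (1, 1) := (i.prod (Path.refl 0)).trans ((Path.refl 1).prod i)
  have hp (t : I) : Q (p t) = (a.trans b) t := by
    simp only [p, Path.trans_apply]
    split_ifs
    · exact ha _
    · exact hb _
  have hq (t : I) : Q (q t) = (c.trans d) t := by
    simp only [q, Path.trans_apply]
    split_ifs
    · exact hc _
    · exact hd _
  -- The square is contractible, so its two edge paths from (0,0) to (1,1) are homotopic; `Q`
  -- carries this homotopy to `Y`.
  have : ContractibleSpace I := (convex_Icc (0 : ℝ) 1).contractibleSpace ⟨0, by simp⟩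
  obtain ⟨H⟩ : p.Homotopic q := SimplyConnectedSpace.paths_homotopic p q
  refine ⟨⟨⟨Q.comp H.toContinuousMap, ?_, ?_⟩, ?_⟩⟩
  · exact fun t => (congrArg Q (H.apply_zero t)).trans (hp t)
  · exact fun t => (congrArg Q (H.apply_one t)).trans (hq t)
  · exact fun τ t ht => (congrArg Q (H.eq_fst τ ht)).trans (hp t)

/-- If `f` becomes `g` when carried around `l`, then `g` is the conjugate of `f` by `l` in the Abe
group. -/
theorem CarriedAround.ofPiOne_mul_ofPiN {l : Path x x} {f g : GenLoop (Fin n) X x}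
    (h : CarriedAround l f g) :
    ofPiOne n (Path.Homotopic.Quotient.mk l) * ofPiN n ⟦f⟧ =
      ofPiN n ⟦g⟧ * ofPiOne n (Path.Homotopic.Quotient.mk l) := by
  obtain ⟨H, hf, hg, hH⟩ := h
  let K : C(I × (I × (Rest n → I)), X) := H.comp
    ((ContinuousMap.id I).prodMap (Cube.insertAt (0 : Fin n) : C(I × (Rest n → I), I^(Fin n))))
  have hK : ∀ τ t, ∀ y ∈ Cube.boundary (Rest n), ∀ y' ∈ Cube.boundary (Rest n),
      K (τ, (t, y)) = K (τ, (t, y')) := fun τ t y hy y' hy' =>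
    (hH τ _ (Cube.insertAt_boundary 0 (Or.inr hy))).trans
      (hH τ _ (Cube.insertAt_boundary 0 (Or.inr hy'))).symm
  -- In the square `Q (s, t)`, s is the time along `l` and t the cylinder coordinate. The edges s =
  -- 0, 1 are `f` and `g`; the edges t = 0, 1 are both `l`, because the ends of the cylinder lie on
  -- the boundary of the n-cube.
  let Q : C(I × I, C(Sphere n, X)) := ((liftFamily K hK).comp
    (Homeomorph.prodAssoc I I (Sphere n) : C(_, _))).curry
  have hQ (s t : I) (y : Rest n → I) :
      Q (s, t) (collapse n y) = H (s, Cube.insertAt (0 : Fin n) (t, y)) :=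
    liftFamily_apply K hK s t y
  change AbeGroup.mk (ofLoop n l) * AbeGroup.mk (ofGenLoop f) =
    AbeGroup.mk (ofGenLoop g) * AbeGroup.mk (ofLoop n l)
  rw [AbeGroup.mk_mul_mk, AbeGroup.mk_mul_mk]
  apply Quotient.sound
  change ContinuousMap.HomotopicRel _ _ _
  rw [AbeLoop.homotopic_iff, AbeLoop.trans, AbeLoop.trans, Equiv.apply_symm_apply,
    Equiv.apply_symm_apply]
  refine Path.Homotopic.of_square Q (fun t => ?_) (fun s => ?_) (fun s => ?_) (fun t => ?_) <;>
    ext p <;> obtain ⟨y, rfl⟩ := collapse_surjective p <;> rw [hQ]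
  · exact (hf _).trans (ofGenLoop_apply f t y).symm
  · exact hH s _ (Cube.insertAt_boundary 0 (Or.inl (Or.inr rfl)))
  · exact hH s _ (Cube.insertAt_boundary 0 (Or.inl (Or.inl rfl)))
  · exact (hg _).trans (ofGenLoop_apply g t y).symm

end

/-! ### Expanding the cube from its centre -/

section Stretch

variable {N : Type*}

/-- The map of the cube that expands it from its centre by the factor `1 + τ` and then retracts it
to the original size. It interpolates between the identity and `expand`. -/
def stretch (τ : I) (y : N → I) : N → I :=
  fun j => Set.projIcc 0 1 zero_le_one ((1 + τ : ℝ) * y j - τ / 2)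

theorem continuous_stretch : Continuous fun z : I × (N → I) => stretch z.1 z.2 := by
  unfold stretch; fun_prop

theorem stretch_zero (y : N → I) : stretch 0 y = y := by
  funext j
  simp [stretch]

theorem stretch_one (y : Fin n → I) : stretch 1 y = expand y := by
  funext j
  simp only [stretch, expand, Set.Icc.coe_one]
  congr 1
  ring

/-- With `stretch_eq_one`, this gives the preservation of faces that `GenLoop.homotopic_of_comp`
requires of a reparametrization. -/
theorem stretch_eq_zero (τ : I) {y : N → I} {j : N} (h : y j = 0) : stretch τ y j = 0 := by
  refine Set.projIcc_of_le_left _ ?_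
  rw [h, Set.Icc.coe_zero]
  linarith [τ.2.1]

theorem stretch_eq_one (τ : I) {y : N → I} {j : N} (h : y j = 1) : stretch τ y j = 1 := by
  refine Set.projIcc_of_right_le _ ?_
  rw [h, Set.Icc.coe_one]
  linarith [τ.2.1]

variable [Fintype N]

/-- Expansion multiplies the radius by 1 + τ, so a coordinate realising the radius reaches or leaves
[0,1] and is clamped to 0 or 1. -/
theorem stretch_mem_boundary {τ : I} {y : N → I} (h : 1 ≤ (1 + τ : ℝ) * radius y) :
    stretch τ y ∈ Cube.boundary N := by
  obtain ⟨j, hj⟩ := exists_abs_eq_radius y fun h0 => by rw [h0] at h; linarith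
  refine ⟨j, ?_⟩
  rw [← hj] at h
  rcases abs_cases (2 * (y j : ℝ) - 1) with ⟨h', -⟩ | ⟨h', -⟩ <;> rw [h'] at h
  · right
    exact Set.projIcc_of_right_le _ (by linarith)
  · left
    exact Set.projIcc_of_le_left _ (by linarith)

/-- How far the point `y` of the cube is moved out of the cube in the definition of `stretch`. -/
def excess (τ : I) (y : N → I) : I :=
  Set.projIcc 0 1 zero_le_one ((1 + τ : ℝ) * radius y - 1)

theorem continuous_excess : Continuous fun z : I × (N → I) => excess z.1 z.2 := by
  have hr : Continuous (radius : (N → I) → ℝ) := continuous_radius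
  unfold excess; fun_prop

theorem excess_zero (y : N → I) : excess 0 y = 0 :=
  Set.projIcc_of_le_left _ (by simpa using radius_le_one y)

theorem excess_of_mem_boundary (τ : I) {y : N → I} (hy : y ∈ Cube.boundary N) :
    excess τ y = τ := by
  rw [excess, (radius_eq_one_iff y).2 hy]
  apply Subtype.ext
  rw [show (1 + τ : ℝ) * 1 - 1 = τ by ring, Set.projIcc_of_mem zero_le_one τ.2]

/-- This dichotomy makes the formulas below consistent: where the excess is nonzero, the stretched
point is on the boundary and collapses to the pole. -/
theorem excess_eq_zero_or (τ : I) (y : N → I) :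
    excess τ y = 0 ∨ stretch τ y ∈ Cube.boundary N := by
  rcases le_total ((1 + τ : ℝ) * radius y) 1 with h | h
  · exact Or.inl (Set.projIcc_of_le_left _ (by linarith))
  · exact Or.inr (stretch_mem_boundary h)

end Stretch

/-- An excitation that is carried around `l` can be grown inward while the values of `l` are laid
down around it. -/
theorem carriedAround_actLoop (l : Path x x) (f : GenLoop (Fin n) X x) :
    CarriedAround l f (actLoop l f) := by
  have hr : Continuous (radius : (Fin n → I) → ℝ) := continuous_radius
  have hs : Continuous fun z : I × (Fin n → I) => stretch z.1 z.2 := continuous_stretch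
  have he : Continuous fun z : I × (Fin n → I) => excess z.1 z.2 := continuous_excess
  refine ⟨⟨fun z => if (1 + z.1 : ℝ) * radius z.2 ≤ 1 then f (stretch z.1 z.2)
    else l (excess z.1 z.2), ?_⟩, fun y => ?_, fun y => ?_, fun t y hy => ?_⟩
  · refine Continuous.if_le (by fun_prop) (by fun_prop) (by fun_prop) continuous_const ?_
    -- On the interface both branches equal the base point: `f` is evaluated on the boundary, `l` at
    -- its start.
    rintro ⟨τ, y⟩ h
    have h0 : excess τ y = 0 := Set.projIcc_of_le_left _ (sub_nonpos.2 h.le)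
    rw [h0, l.source]
    exact f.2 _ (stretch_mem_boundary h.ge)
  · have := radius_le_one y
    simp [this, stretch_zero]
  · rw [actLoop_apply]
    have h2 : ((1 : I) : ℝ) = 1 := rfl
    have h3 : (1 + 1 : ℝ) * radius y ≤ 1 ↔ radius y ≤ 1 / 2 := by constructor <;> intro <;> linarith
    simp only [ContinuousMap.coe_mk, stretch_one, h2, h3, excess]
    norm_num only
  · change ite _ _ _ = _
    rw [excess_of_mem_boundary t hy]
    split_ifs with h
    -- A boundary point falls in the inner branch only at time 0.
    · rw [(radius_eq_one_iff y).2 hy] at h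
      have ht : t = 0 := Subtype.ext (le_antisymm (by simpa using h) t.2.1)
      rw [ht, stretch_zero, l.source]
      exact f.2 y hy
    · rfl

/-- The excitation `actLoop l f` is a result of carrying `f` around `l`, so a nontrivial action is
already a change of charge. -/
theorem vorticesInfluence_of_not_isSimple (h : ¬ IsSimple n X x) : VorticesInfluence n X x := by
  simp only [IsSimple, not_forall] at h
  obtain ⟨γ, α, h⟩ := h
  obtain ⟨l, rfl⟩ := Quotient.exists_rep γ
  obtain ⟨f, rfl⟩ := Quotient.exists_rep α
  exact ⟨l, f, actLoop l f, carriedAround_actLoop l f, fun h' => h h'.symm⟩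

/-- Composing a map of the cube with a map that keeps each coordinate with value `0` or `1` does not
change its homotopy class. -/
theorem GenLoop.homotopic_of_comp {N : Type*} {f g : GenLoop N X x} (θ : C(N → I, N → I))
    (h0 : ∀ y j, y j = 0 → θ y j = 0) (h1 : ∀ y j, y j = 1 → θ y j = 1)
    (hg : ∀ y, g y = f (θ y)) : GenLoop.Homotopic g f := by
  -- The straight-line homotopy from `θ` to the identity; faces are convex and preserved by `θ`, so
  -- they are preserved throughout.
  let D : C(I × (N → I), N → I) :=
    ⟨fun z j => ⟨(1 - z.1 : ℝ) * θ z.2 j + z.1 * z.2 j,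
      (convex_Icc (0 : ℝ) 1) (θ z.2 j).2 (z.2 j).2 (sub_nonneg.2 z.1.2.2) z.1.2.1 (by ring)⟩,
      by fun_prop⟩
  refine ⟨⟨⟨f.1.comp D, fun y => ?_, fun y => ?_⟩, fun τ y hy => ?_⟩⟩
  · refine (congrArg f ?_).trans (hg y).symm
    funext j; apply Subtype.ext; simp [D]
  · refine congrArg f ?_
    funext j; apply Subtype.ext; simp [D]
  · refine (f.2 _ ?_).trans (g.2 y hy).symm
    obtain ⟨j, hj | hj⟩ := hy
    · refine ⟨j, Or.inl (Subtype.ext ?_)⟩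
      simp [D, hj, h0 y j hj]
    · refine ⟨j, Or.inr (Subtype.ext ?_)⟩
      simp [D, hj, h1 y j hj]

/-- A map of the cylinder, seen as a constant family. -/
def AbeLoop.constFamily (F : AbeLoop n X x) : C(I × (I × Sphere n), X) :=
  F.1.comp ⟨Prod.snd, continuous_snd⟩

theorem AbeLoop.constFamily_zero (F : AbeLoop n X x) (τ : I) (p : Sphere n) :
    F.constFamily (τ, (0, p)) = x := F.2 (0, p) (Or.inl rfl)

theorem AbeLoop.constFamily_one (F : AbeLoop n X x) (τ : I) (p : Sphere n) :
    F.constFamily (τ, (1, p)) = x := F.2 (1, p) (Or.inr rfl)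

/-! ### Exactness: π_n embeds as the kernel of the side map -/

section Squeeze

variable [n.AtLeastTwo]

/-- A family of maps `F τ` of the cylinder, followed by the inverses of their sides over the pole,
and with these sides, composed with their inverses, contracted in a collar of width given by `e`. -/
def squeeze (F : C(I × (I × Sphere n), X)) (hF : ∀ τ p, F (τ, (1, p)) = x) (e : C(I, I)) :
    C(I × (I × (Rest n → I)), X) where
  toFun z :=
    if (z.2.1 : ℝ) ≤ 1 / 2 then
      F (z.1, (min (Set.projIcc 0 1 zero_le_one (2 * z.2.1 : ℝ)) (σ (excess (e z.1) z.2.2)),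
        collapse n (stretch (e z.1) z.2.2)))
    else
      F (z.1, (min (σ (Set.projIcc 0 1 zero_le_one (2 * z.2.1 - 1 : ℝ)))
        (σ (excess (e z.1) z.2.2)), pole n))
  continuous_toFun := by
    have hs : Continuous fun z : I × (I × (Rest n → I)) => stretch (e z.1) z.2.2 :=
      continuous_stretch.comp (by fun_prop : Continuous fun z : I × (I × (Rest n → I)) =>
        (e z.1, z.2.2))
    have he : Continuous fun z : I × (I × (Rest n → I)) => excess (e z.1) z.2.2 :=
      continuous_excess.comp (by fun_prop : Continuous fun z : I × (I × (Rest n → I)) =>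
        (e z.1, z.2.2))
    refine Continuous.if_le (by fun_prop) (by fun_prop) (by fun_prop) continuous_const ?_
    rintro ⟨τ, t, y⟩ (h : (t : ℝ) = 1 / 2)
    have h1 : Set.projIcc 0 1 zero_le_one (2 * t : ℝ) = (1 : I) :=
      Set.projIcc_of_right_le _ (by linarith)
    have h2 : Set.projIcc 0 1 zero_le_one (2 * t - 1 : ℝ) = (0 : I) :=
      Set.projIcc_of_le_left _ (by linarith)
    dsimp only
    rw [h1, h2, unitInterval.symm_zero, min_eq_right unitInterval.le_one']
    -- At t = 1/2 the halves agree for one of two reasons: without excess both are at the end 1 of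
    -- the cylinder, where `F` is `x`; otherwise both are over the pole.
    rcases excess_eq_zero_or (e τ) y with h | h
    · rw [h, unitInterval.symm_zero, hF, hF]
    · rw [(collapse_eq_pole_iff _).2 h]

variable {F : C(I × (I × Sphere n), X)} {hF : ∀ τ p, F (τ, (1, p)) = x} {e : C(I, I)}

theorem squeeze_apply (τ t : I) (y : Rest n → I) : squeeze F hF e (τ, (t, y)) =
    if (t : ℝ) ≤ 1 / 2 then
      F (τ, (min (Set.projIcc 0 1 zero_le_one (2 * t : ℝ)) (σ (excess (e τ) y)),
        collapse n (stretch (e τ) y)))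
    else
      F (τ, (min (σ (Set.projIcc 0 1 zero_le_one (2 * t - 1 : ℝ))) (σ (excess (e τ) y)),
        pole n)) := rfl

theorem squeeze_ends (hF' : ∀ τ p, F (τ, (0, p)) = x) (τ : I) {t : I} (ht : t = 0 ∨ t = 1)
    (y : Rest n → I) : squeeze F hF e (τ, (t, y)) = x := by
  have h0 : (0 : I) ≤ σ (excess (e τ) y) := unitInterval.nonneg'
  rw [squeeze_apply]
  rcases ht with rfl | rfl
  · simp [hF', h0]
  · norm_num [hF', h0]

/-- Over the boundary the stretched point is the pole and the excess is `e τ`, so the value does not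
depend on `y` and the family descends to the cylinder. -/
theorem squeeze_boundary (τ t : I) {y y' : Rest n → I} (hy : y ∈ Cube.boundary (Rest n))
    (hy' : y' ∈ Cube.boundary (Rest n)) :
    squeeze F hF e (τ, (t, y)) = squeeze F hF e (τ, (t, y')) := by
  have hs (y : Rest n → I) (hy : y ∈ Cube.boundary (Rest n)) :
      collapse n (stretch (e τ) y) = pole n := by
    refine (collapse_eq_pole_iff _).2 (stretch_mem_boundary ?_)
    rw [(radius_eq_one_iff y).2 hy]
    linarith [(e τ).2.1]
  rw [squeeze_apply, squeeze_apply, hs y hy, hs y' hy', excess_of_mem_boundary _ hy,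
    excess_of_mem_boundary _ hy']

/-- At full width the path along the side and back is cut off at time 1 - 1 = 0, so only the base
point remains. -/
theorem squeeze_sides (hF' : ∀ τ p, F (τ, (0, p)) = x) {τ : I} (he : e τ = 1) (t : I)
    {y : Rest n → I} (hy : y ∈ Cube.boundary (Rest n)) : squeeze F hF e (τ, (t, y)) = x := by
  rw [squeeze_apply, excess_of_mem_boundary _ hy, he, unitInterval.symm_one,
    min_eq_right unitInterval.nonneg', min_eq_right unitInterval.nonneg', hF', hF', ite_self]

theorem squeeze_splitAt_boundary (hF' : ∀ τ p, F (τ, (0, p)) = x) {τ : I} (he : e τ = 1)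
    {w : Fin n → I} (hw : w ∈ Cube.boundary (Fin n)) :
    squeeze F hF e (τ, Cube.splitAt (0 : Fin n) w) = x := by
  obtain ⟨j, hj⟩ := hw
  by_cases h : j = 0
  · subst h
    exact squeeze_ends hF' τ hj _
  · exact squeeze_sides hF' he _ ⟨⟨j, h⟩, hj⟩

/-- The map of the cube obtained from a map `F` of the cylinder by multiplication with the inverse
of its side, and contraction of the sides of the result. -/
def AbeLoop.toGenLoop (F : AbeLoop n X x) : GenLoop (Fin n) X x :=
  ⟨(squeeze F.constFamily F.constFamily_one (ContinuousMap.const I 1)).comp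
      ⟨fun w => (1, Cube.splitAt (0 : Fin n) w), by fun_prop⟩,
    fun _ hw => squeeze_splitAt_boundary (hF := F.constFamily_one) F.constFamily_zero rfl hw⟩

theorem AbeLoop.toGenLoop_apply (F : AbeLoop n X x) (w : Fin n → I) : F.toGenLoop w =
    if (w 0 : ℝ) ≤ 1 / 2 then
      F.1 (min (Set.projIcc 0 1 zero_le_one (2 * w 0 : ℝ)) (σ (excess 1 fun j : Rest n => w j)),
        collapse n (stretch 1 fun j : Rest n => w j))
    else
      F.1 (min (σ (Set.projIcc 0 1 zero_le_one (2 * w 0 - 1 : ℝ)))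
        (σ (excess 1 fun j : Rest n => w j)), pole n) := rfl

theorem AbeLoop.toGenLoop_homotopic {F G : AbeLoop n X x}
    (h : F.1.HomotopicRel G.1 (cylinderEnds n)) :
    GenLoop.Homotopic F.toGenLoop G.toGenLoop := by
  obtain ⟨H⟩ := h
  have h0 (τ : I) (p : Sphere n) : H.toContinuousMap (τ, (0, p)) = x :=
    (H.eq_fst τ (Or.inl rfl)).trans (F.2 (0, p) (Or.inl rfl))
  have h1 (τ : I) (p : Sphere n) : H.toContinuousMap (τ, (1, p)) = x :=
    (H.eq_fst τ (Or.inr rfl)).trans (F.2 (1, p) (Or.inr rfl))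
  refine ⟨⟨⟨(squeeze H.toContinuousMap h1 (ContinuousMap.const I 1)).comp
    ⟨fun z => (z.1, Cube.splitAt (0 : Fin n) z.2), by fun_prop⟩, fun w => ?_, fun w => ?_⟩,
    fun τ w hw => ?_⟩⟩
  · change ite _ (H (0, _)) (H (0, _)) = _
    rw [H.apply_zero, H.apply_zero]
    rfl
  · change ite _ (H (1, _)) (H (1, _)) = _
    rw [H.apply_one, H.apply_one]
    rfl
  · exact (squeeze_splitAt_boundary (hF := h1) h0 rfl hw).trans (F.toGenLoop.2 w hw).symm

theorem toGenLoop_ofGenLoop_homotopic (f : GenLoop (Fin n) X x) :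
    GenLoop.Homotopic (ofGenLoop f).toGenLoop f := by
  -- The side of `ofGenLoop f` is constant, so squeezing only reparametrizes `f`: the first
  -- coordinate runs at double speed and then waits, the others are stretched.
  let θ : C(Fin n → I, Fin n → I) :=
    ⟨fun w j => if j = 0 then Set.projIcc 0 1 zero_le_one (2 * w 0 : ℝ) else stretch 1 w j, by
      refine continuous_pi fun j => ?_
      have : Continuous fun w : Fin n → I => stretch 1 w :=
        continuous_stretch.comp (by fun_prop : Continuous fun w : Fin n → I => ((1 : I), w))
      split_ifs <;> fun_prop⟩
  have hθ (w : Fin n → I) : θ w = Cube.insertAt (0 : Fin n)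
      (Set.projIcc 0 1 zero_le_one (2 * w 0 : ℝ), stretch 1 fun j : Rest n => w j) := by
    funext j
    by_cases h : j = 0
    · subst h; simp [θ]
    · simp [θ, h, stretch]
  refine GenLoop.homotopic_of_comp θ ?_ ?_ fun w => ?_
  · intro w j hj
    by_cases h : j = 0
    · subst h; simp [θ, hj]
    · simp [θ, h, stretch_eq_zero 1 hj]
  · intro w j hj
    by_cases h : j = 0
    · subst h
      simp only [θ, ContinuousMap.coe_mk, if_true, hj]
      exact Set.projIcc_of_right_le _ (by norm_num)
    · simp [θ, h, stretch_eq_one 1 hj]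
  · rw [AbeLoop.toGenLoop_apply, hθ]
    split_ifs with h
    · rw [ofGenLoop_apply]
      -- The cut-off by `min` is harmless: it acts only where `f` takes the value `x` anyway.
      rcases excess_eq_zero_or 1 (fun j : Rest n => w j) with h' | h'
      · rw [h', unitInterval.symm_zero, min_eq_left unitInterval.le_one']
      · exact (f.2 _ (Cube.insertAt_boundary 0 (Or.inr h'))).trans
          (f.2 _ (Cube.insertAt_boundary 0 (Or.inr h'))).symm
    · rw [ofGenLoop_pole]
      refine (f.2 _ (Cube.insertAt_boundary 0 (Or.inl (Or.inr ?_)))).symm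
      exact Set.projIcc_of_right_le _ (by linarith)

/-- `AbeLoop.toGenLoop` respects homotopy and is a left inverse of `ofGenLoop` up to homotopy. -/
theorem ofPiN_injective : Function.Injective (ofPiN n : π_ n X x → AbeGroup n X x) := by
  intro α β h
  obtain ⟨f, rfl⟩ := Quotient.exists_rep α
  obtain ⟨g, rfl⟩ := Quotient.exists_rep β
  apply Quotient.sound
  have h' : (ofGenLoop f).1.HomotopicRel (ofGenLoop g).1 (cylinderEnds n) := Quotient.exact h
  exact ((toGenLoop_ofGenLoop_homotopic f).symm.trans (AbeLoop.toGenLoop_homotopic h')).trans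
    (toGenLoop_ofGenLoop_homotopic g)

/-- Each element of the Abe group is an element of `π_n` times its side. -/
theorem AbeLoop.mk_ofGenLoop_toGenLoop (F : AbeLoop n X x) :
    AbeGroup.mk (F.trans (ofLoop n (F.side (pole n)).symm)) =
      AbeGroup.mk (ofGenLoop F.toGenLoop) := by
  -- With collar width `e τ = τ`, the family starts at `F` followed by its inverse side and ends at
  -- the squeezed map.
  let K := squeeze F.constFamily F.constFamily_one (ContinuousMap.id I)
  have hK : ∀ τ t, ∀ y ∈ Cube.boundary (Rest n), ∀ y' ∈ Cube.boundary (Rest n),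
      K (τ, (t, y)) = K (τ, (t, y')) := fun τ t y hy y' hy' =>
    squeeze_boundary (hF := F.constFamily_one) τ t hy hy'
  apply Quotient.sound
  refine ⟨⟨⟨liftFamily K hK, ?_, ?_⟩, ?_⟩⟩
  · rintro ⟨t, p⟩
    obtain ⟨y, rfl⟩ := collapse_surjective p
    refine (liftFamily_apply K hK 0 t y).trans ?_
    rw [squeeze_apply, ContinuousMap.id_apply, excess_zero, stretch_zero, unitInterval.symm_zero,
      min_eq_left unitInterval.le_one', min_eq_left unitInterval.le_one']
    exact (F.trans_apply (ofLoop n (F.side (pole n)).symm) t (collapse n y)).symm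
  · rintro ⟨t, p⟩
    obtain ⟨y, rfl⟩ := collapse_surjective p
    refine (liftFamily_apply K hK 1 t y).trans ?_
    refine Eq.trans ?_ (ofGenLoop_apply _ _ _).symm
    rw [AbeLoop.toGenLoop_apply, squeeze_apply]
    simp only [ContinuousMap.id_apply]
    have e0 : Cube.insertAt (0 : Fin n) (t, y) 0 = t := by simp
    have e1 : (fun j : Rest n => Cube.insertAt (0 : Fin n) (t, y) j) = y := by
      funext j; simp [j.2]
    rw [e0, e1]
    rfl
  · rintro τ ⟨t, p⟩ ht
    obtain ⟨y, rfl⟩ := collapse_surjective p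
    refine (liftFamily_apply K hK τ t y).trans ?_
    rw [squeeze_ends F.constFamily_zero τ ht y]
    exact ((F.trans (ofLoop n (F.side (pole n)).symm)).2 _ ht).symm

end Squeeze

/-! ### The split exact sequence and its conjugation action -/

variable [n.AtLeastTwo]

/-- `ofPiOne` as a homomorphism of groups. -/
def ofPiOneHom (n : ℕ) : FundamentalGroup X x →* AbeGroup n X x :=
  MonoidHom.mk' (ofPiOne n) ofPiOne_mul

/-- `ofPiN` as a homomorphism of groups. -/
def ofPiNHom (n : ℕ) [n.AtLeastTwo] : π_ n X x →* AbeGroup n X x :=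
  MonoidHom.mk' (ofPiN n) ofPiN_mul

theorem range_ofPiNHom :
    (ofPiNHom n : π_ n X x →* AbeGroup n X x).range = (AbeGroup.side (pole n)).ker := by
  ext k
  constructor
  · rintro ⟨α, rfl⟩
    exact AbeGroup.side_ofPiN α
  · intro hk
    obtain ⟨F, rfl⟩ := Quotient.exists_rep k
    -- Multiplying by the inverse of the side puts any element in the image of π_n; on the kernel
    -- that factor is 1.
    have h : (ofPiOneHom n (AbeGroup.side (pole n) (AbeGroup.mk F))⁻¹) * AbeGroup.mk F =
        ofPiN n ⟦F.toGenLoop⟧ :=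
      (AbeGroup.mk_mul_mk _ _).trans F.mk_ofGenLoop_toGenLoop
    have hk' : AbeGroup.side (pole n) (AbeGroup.mk F) = 1 := hk
    rw [hk', inv_one, map_one, one_mul] at h
    exact ⟨⟦F.toGenLoop⟧, h.symm⟩

/-- The action of `π₁` on `π_n` is conjugation in the Abe group. -/
theorem ofPiOne_mul_ofPiN (γ : FundamentalGroup X x) (α : π_ n X x) :
    ofPiOne n γ * ofPiN n α = ofPiN n (act γ α) * ofPiOne n γ := by
  obtain ⟨l, rfl⟩ := Quotient.exists_rep γ
  obtain ⟨f, rfl⟩ := Quotient.exists_rep α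
  exact (carriedAround_actLoop l f).ofPiOne_mul_ofPiN

/-- If `l` and `f` commuted in κ_n, conjugation would fix `f`, and injectivity of π_n → κ_n would
force [f] = [g]. -/
theorem exists_not_commute_of_vorticesInfluence (h : VorticesInfluence n X x) :
    ∃ (γ : FundamentalGroup X x) (α : π_ n X x),
      ofPiOne n γ * ofPiN n α ≠ ofPiN n α * ofPiOne n γ := by
  obtain ⟨l, f, g, h, hne⟩ := h
  refine ⟨Path.Homotopic.Quotient.mk l, ⟦f⟧, fun hc => hne ?_⟩
  rw [h.ofPiOne_mul_ofPiN] at hc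
  exact (ofPiN_injective (mul_right_cancel hc)).symm

end AbeHomotopy
end

theorem theorem2 {X : Type*} [TopologicalSpace X] (x : X) (n : ℕ) [n.AtLeastTwo] :
    List.TFAE [
      AbeHomotopy.VorticesInfluence n X x,
      ¬ AbeHomotopy.IsSimple n X x,
      ∃ (γ : FundamentalGroup X x) (α : HomotopyGroup.Pi n X x),
        AbeHomotopy.ofPiOne n γ * AbeHomotopy.ofPiN n α ≠
          AbeHomotopy.ofPiN n α * AbeHomotopy.ofPiOne n γ,
      ∃ (φ : FundamentalGroup X x →* MulAut (HomotopyGroup.Pi n X x))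
        (e : AbeHomotopy.AbeGroup n X x ≃* HomotopyGroup.Pi n X x ⋊[φ] FundamentalGroup X x),
        (∀ α, e (AbeHomotopy.ofPiN n α) = SemidirectProduct.inl α) ∧
        (∀ γ, e (AbeHomotopy.ofPiOne n γ) = SemidirectProduct.inr γ) ∧
        φ ≠ 1] := by
  tfae_have 1 → 3 := AbeHomotopy.exists_not_commute_of_vorticesInfluence
  tfae_have 2 → 1 := AbeHomotopy.vorticesInfluence_of_not_isSimple
  tfae_have 3 → 2 := by
    rintro ⟨γ, α, h⟩ hs
    rw [AbeHomotopy.ofPiOne_mul_ofPiN, hs γ α] at h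
    exact h rfl
  -- The semidirect decomposition exists in every case; a noncommuting pair serves only to show `φ ≠
  -- 1`.
  tfae_have 3 → 4 := by
    rintro ⟨γ, α, h⟩
    obtain ⟨φ, e, hN, hP, hφ⟩ := SemidirectProduct.exists_mulEquiv_of_retraction
      (AbeHomotopy.ofPiNHom n) (AbeHomotopy.ofPiOneHom n)
      (AbeHomotopy.AbeGroup.side (AbeHomotopy.pole n)) AbeHomotopy.ofPiN_injective
      (AbeHomotopy.AbeGroup.side_ofPiOne _) (AbeHomotopy.range_ofPiNHom (X := X) (x := x))
    refine ⟨φ, e, hN, hP, fun h1 => h ?_⟩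
    have hc := hφ γ α
    rw [h1, eq_mul_inv_iff_mul_eq] at hc
    exact hc.symm
  -- Here `φ` is not assumed to be the geometric action, but in any semidirect product it is
  -- conjugation, so commuting factors would make it trivial.
  tfae_have 4 → 3 := by
    rintro ⟨φ, e, hN, hP, hφ⟩
    by_contra! hc
    refine hφ (MonoidHom.ext fun γ => MulEquiv.ext fun α => ?_)
    apply SemidirectProduct.inl_injective (φ := φ)
    rw [SemidirectProduct.inl_aut, ← hN α, map_inv, mul_inv_eq_iff_eq_mul, ← hP γ, ← map_mul, hc,
      map_mul, hN α, MonoidHom.one_apply, MulAut.one_apply]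
  tfae_finish
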